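/- Let $\mathcal A,\mathcal B,\mathcal E$ be finite alphabets and let $(A,B,E)$ have joint probability mass function $p(a,b,e)$ on $\mathcal A\times\mathcal B\times\mathcal E$; let $(A^N,B^N,E^N)$ be $N$ i.i.d. copies of $(A,B,E)$. Entropies and mutual informations are in bits. For real $R$ and $N\ge 1$, an $(R,N)$ code (with uncoded side information at Bob) consists of a deterministic encoder $f:\mathcal A^N\to\{1,\dots,\lfloor 2^{NR}\rfloor\}$ at Alice and a decoder $g:\{1,\dots,\lfloor 2^{NR}\rfloor\}\times\mathcal B^N\to\mathcal A^N$ at Bob. A pair $(R_A,\Delta)\in\mathbb R^2$ is achievable if for every $\epsilon>0$ there exist $N\ge 1$ and an $(R_A+\epsilon,N)$ code such that $$H(A^N\mid f(A^N),E^N)\ \ge\ N\Delta\qquad\text{and}\qquad P\big(g(f(A^N),B^N)\neq A^N\big)<\epsilon .$$ Suppose that Bob's side information $B$ is less noisy than Eve's side information $E$, i.e. $I(U;E)\le I(U;B)$ for every finite-valued $U$ with joint distribution of the form $p(a,b,e)\,p(u\mid a)$. Then $(R_A,\Delta)$ is achievable if and only if $$R_A\ \ge\ H(A\mid B)\qquad\text{and}\qquad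 \Delta\ \le\ I(A;B)-I(A;E).$$ Moreover, for every finite-valued $U$ with joint distribution of the form $p(a,b,e)\,p(u\mid a)$, one has $I(A;B\mid U)-I(A;E\mid U)\le I(A;B)-I(A;E)$; that is, a constant $U$ maximizes $I(A;B\mid U)-I(A;E\mid U)$. -/

import Mathlib

open Finset

noncomputable section

namespace SecureCompression

/-! Information measures (in bits) of random variables on a finite sample space `Ω` with
probability mass function `P : Ω → ℝ`. -/

section Information

variable {Ω S T V : Type*} [Fintype Ω] [Fintype S] [Fintype T] [Fintype V]

open Classical in
/-- The probability of the event `ev` under the probability mass function `P`. -/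
def prob (P : Ω → ℝ) (ev : Ω → Prop) : ℝ := ∑ ω with ev ω, P ω

/-- The conditional entropy `H(X|Y)` in bits, `- ∑ p(x,y) log₂ p(x|y)`
(terms with `p(x,y) = 0` vanish). -/
def condEntropy (P : Ω → ℝ) (X : Ω → S) (Y : Ω → T) : ℝ :=
  - ∑ x, ∑ y, prob P (fun ω => X ω = x ∧ Y ω = y) *
      Real.logb 2 (prob P (fun ω => X ω = x ∧ Y ω = y) / prob P (fun ω => Y ω = y))

/-- The mutual information `I(X;Y)` in bits, `∑ p(x,y) log₂ (p(x,y) / (p(x) p(y)))`. -/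
def mutualInfo (P : Ω → ℝ) (X : Ω → S) (Y : Ω → T) : ℝ :=
  ∑ x, ∑ y, prob P (fun ω => X ω = x ∧ Y ω = y) *
    Real.logb 2 (prob P (fun ω => X ω = x ∧ Y ω = y) /
      (prob P (fun ω => X ω = x) * prob P (fun ω => Y ω = y)))

/-- The conditional mutual information `I(X;Y|Z)` in bits,
`∑ p(x,y,z) log₂ (p(x,y,z) p(z) / (p(x,z) p(y,z)))`. -/
def condMutualInfo (P : Ω → ℝ) (X : Ω → S) (Y : Ω → T) (Z : Ω → V) : ℝ :=
  ∑ x, ∑ y, ∑ z, prob P (fun ω => X ω = x ∧ Y ω = y ∧ Z ω = z) *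
    Real.logb 2 (prob P (fun ω => X ω = x ∧ Y ω = y ∧ Z ω = z) * prob P (fun ω => Z ω = z) /
      (prob P (fun ω => X ω = x ∧ Z ω = z) * prob P (fun ω => Y ω = y ∧ Z ω = z)))

end Information

section Model

variable {A B E : Type*}

/-- The letter of Alice in `(a, b, e)`. -/
def srcA (ω : A × B × E) : A := ω.1

/-- The letter of Bob in `(a, b, e)`. -/
def srcB (ω : A × B × E) : B := ω.2.1

/-- The letter of Eve in `(a, b, e)`. -/
def srcE (ω : A × B × E) : E := ω.2.2

/-- The joint probability mass function of `N` i.i.d. copies of `(A, B, E)`. -/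
def iid (p : A × B × E → ℝ) (N : ℕ) : (Fin N → A × B × E) → ℝ :=
  fun ω => ∏ i, p (ω i)

/-- The source sequence `A^N` of Alice. -/
def seqA {N : ℕ} (ω : Fin N → A × B × E) : Fin N → A := fun i => srcA (ω i)

/-- The side information sequence `B^N` of Bob. -/
def seqB {N : ℕ} (ω : Fin N → A × B × E) : Fin N → B := fun i => srcB (ω i)

/-- The side information sequence `E^N` of Eve. -/
def seqE {N : ℕ} (ω : Fin N → A × B × E) : Fin N → E := fun i => srcE (ω i)

/-- An `(R, N)` code with uncoded side information at Bob: a deterministic encoder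
`A^N → {1, …, ⌊2^{NR}⌋}` and a decoder `{1, …, ⌊2^{NR}⌋} × B^N → A^N`. -/
structure Code (A B : Type*) (R : ℝ) (N : ℕ) where
  /-- the encoder of Alice -/
  enc : (Fin N → A) → Fin ⌊(2 : ℝ) ^ ((N : ℝ) * R)⌋₊
  /-- the decoder of Bob -/
  dec : Fin ⌊(2 : ℝ) ^ ((N : ℝ) * R)⌋₊ → (Fin N → B) → (Fin N → A)

variable [Fintype A] [Fintype B] [Fintype E]

/-- The equivocation `H(A^N | f(A^N), E^N)` of the code at Eve (not divided by `N`). -/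
def Code.equivocation {R : ℝ} {N : ℕ} (c : Code A B R N) (p : A × B × E → ℝ) : ℝ :=
  condEntropy (iid p N) seqA (fun ω => (c.enc (seqA ω), seqE ω))

/-- The error probability `P(g(f(A^N), B^N) ≠ A^N)` of the code. -/
def Code.errorProb {R : ℝ} {N : ℕ} (c : Code A B R N) (p : A × B × E → ℝ) : ℝ :=
  prob (iid p N) (fun ω => c.dec (c.enc (seqA ω)) (seqB ω) ≠ seqA ω)

/-- The rate-equivocation pair `(R, Δ)` is achievable: codes exist whose rate exceeds `R` by
arbitrarily little, whose error probability is arbitrarily small, and whose equivocation rate is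
at least `Δ`. -/
def Achievable (p : A × B × E → ℝ) (R Δ : ℝ) : Prop :=
  ∀ ε : ℝ, 0 < ε → ∃ N : ℕ, 1 ≤ N ∧ ∃ c : Code A B (R + ε) N,
    (N : ℝ) * Δ ≤ c.equivocation p ∧ c.errorProb p < ε

/-- The joint probability mass function `p(a,b,e) p(u|a)`, where `W a u = p(u|a)`. -/
def withAux {k : ℕ} (p : A × B × E → ℝ) (W : A → Fin k → ℝ) : (A × B × E) × Fin k → ℝ :=
  fun ω => p ω.1 * W (srcA ω.1) ω.2

/-- The side information `B` is less noisy than `E`: `I(U;E) ≤ I(U;B)` for every finite-valued `U`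
with joint distribution `p(a,b,e) p(u|a)`. -/
def LessNoisy (p : A × B × E → ℝ) : Prop :=
  ∀ (k : ℕ) (W : A → Fin k → ℝ), (∀ a, W a ∈ stdSimplex ℝ (Fin k)) →
    mutualInfo (withAux p W) (fun ω => ω.2) (fun ω => srcE ω.1) ≤
      mutualInfo (withAux p W) (fun ω => ω.2) (fun ω => srcB ω.1)

end Model

end SecureCompression

end

/-! In both directions the bound on Δ is read as H(A|E) − H(A|B). Since f is deterministic, the
equivocation equals N·H(A,E) − H(f, E^N), so everything turns on the entropy of (f, E^N).

Converse. Fano's inequality makes H(A^N | f, B^N) at most Nκ(ε) with κ(ε) → 0. Since H(f) is at most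
the logarithm of the number of indices, this gives the rate bound. For the equivocation, the
less-noisy order must pass to N copies: I(J;E^N) ≤ I(J;B^N) for J a function of A^N
(`LessNoisy.entropy_seq_le`). This is proved by replacing Eve's letters by Bob's one at a time.
Applied to J = f, it replaces H(f, E^N) by H(f, B^N), which Fano controls.

Achievability. The equivocation is at least N·H(A|E) − H(f), so H(f) ≤ N·H(A|B) is needed with no
slack, whereas Slepian-Wolf binning (`exists_slepianWolf`) needs a rate strictly above H(A|B). If
H(A|B) > 0, the encoder is made constant on an event of fixed small probability s. This lowers the
bound on H(f) by about a factor 1 − s (`entropy_le_of_atom`), a saving linear in N, and costs at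
most s in error probability. If B determines A, a constant encoder with N = 1 is enough.

The last claim follows from I(A;B|U) − I(A;E|U) = I(A;B) − I(A;E) − (I(U;B) − I(U;E)), valid when U
is generated from A alone. -/

namespace SecureCompression

/-! ### Entropy in nats: Gibbs, subadditivity, Fano -/

section Entropy

variable {Ω Ω' S T V : Type*} [Fintype Ω] [Fintype Ω'] {P : Ω → ℝ}

theorem prob_eq_sum_ite (P : Ω → ℝ) (ev : Ω → Prop) [DecidablePred ev] :
    prob P ev = ∑ ω, if ev ω then P ω else 0 := by
  rw [prob, Finset.sum_filter]
  exact Finset.sum_congr rfl fun ω _ => by congr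

theorem prob_congr {ev ev' : Ω → Prop} (h : ∀ ω, ev ω ↔ ev' ω) : prob P ev = prob P ev' := by
  have : ev = ev' := funext fun ω => propext (h ω)
  rw [this]

theorem prob_nonneg (hP : ∀ ω, 0 ≤ P ω) (ev : Ω → Prop) : 0 ≤ prob P ev :=
  Finset.sum_nonneg fun ω _ => hP ω

theorem prob_mono (hP : ∀ ω, 0 ≤ P ω) {ev ev' : Ω → Prop} (h : ∀ ω, 0 < P ω → ev ω → ev' ω) :
    prob P ev ≤ prob P ev' := by
  classical
  simp only [prob_eq_sum_ite]
  refine Finset.sum_le_sum fun ω _ => ?_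
  rcases (hP ω).eq_or_lt with h0 | h0
  · simp [← h0]
  · by_cases h1 : ev ω
    · simp [h1, h ω h0 h1]
    · rw [if_neg h1]; split_ifs <;> simp [hP ω]

theorem prob_pos (hP : ∀ ω, 0 ≤ P ω) {ev : Ω → Prop} {ω : Ω} (h : 0 < P ω) (hω : ev ω) :
    0 < prob P ev := by
  classical
  exact lt_of_lt_of_le h (Finset.single_le_sum (f := P) (fun ω _ => hP ω) (by simpa using hω))

theorem prob_fiber_pos (hP : ∀ ω, 0 ≤ P ω) (X : Ω → S) {ω : Ω} (h : 0 < P ω) :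
    0 < prob P (fun ω' => X ω' = X ω) :=
  prob_pos hP h rfl

theorem prob_or_le (hP : ∀ ω, 0 ≤ P ω) (ev ev' : Ω → Prop) :
    prob P (fun ω => ev ω ∨ ev' ω) ≤ prob P ev + prob P ev' := by
  classical
  simp only [prob_eq_sum_ite, ← Finset.sum_add_distrib]
  refine Finset.sum_le_sum fun ω _ => ?_
  have := hP ω
  by_cases h1 : ev ω <;> by_cases h2 : ev' ω <;> simp [h1, h2, this]

theorem prob_add_prob_not (P : Ω → ℝ) (ev : Ω → Prop) :
    prob P ev + prob P (fun ω => ¬ ev ω) = ∑ ω, P ω := by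
  classical
  simp only [prob_eq_sum_ite, ← Finset.sum_add_distrib]
  refine Finset.sum_congr rfl fun ω _ => ?_
  by_cases h : ev ω <;> simp [h]

/-- Summing over the fibres of a random variable. -/
theorem sum_prob_mul [Fintype S] (P : Ω → ℝ) (X : Ω → S) (F : S → ℝ) :
    ∑ x, prob P (fun ω => X ω = x) * F x = ∑ ω, P ω * F (X ω) := by
  classical
  simp only [prob_eq_sum_ite, Finset.sum_mul]
  rw [Finset.sum_comm]
  refine Finset.sum_congr rfl fun ω _ => ?_
  simp [ite_mul]

theorem sum_prob [Fintype S] (P : Ω → ℝ) (X : Ω → S) :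
    ∑ x, prob P (fun ω => X ω = x) = ∑ ω, P ω := by
  simpa using sum_prob_mul P X (fun _ => 1)

theorem sum_prob_and [Fintype S] (P : Ω → ℝ) (X : Ω → S) (ev : Ω → Prop) :
    ∑ x, prob P (fun ω => X ω = x ∧ ev ω) = prob P ev := by
  classical
  simp only [prob_eq_sum_ite]
  rw [Finset.sum_comm]
  refine Finset.sum_congr rfl fun ω _ => ?_
  by_cases h : ev ω <;> simp [h]

/-- The entropy of a random variable, in nats, written as an expectation. -/
noncomputable def entropy (P : Ω → ℝ) (X : Ω → S) : ℝ :=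
  -∑ ω, P ω * Real.log (prob P (fun ω' => X ω' = X ω))

/-- Entropy sees only the partition into fibres. This justifies every regrouping of tuples and every
removal of a component determined by the others. -/
theorem entropy_congr {X : Ω → S} {Y : Ω → T} (h : ∀ ω ω', X ω = X ω' ↔ Y ω = Y ω') :
    entropy P X = entropy P Y := by
  simp only [entropy, fun ω => prob_congr (P := P) (fun ω' => h ω' ω)]

theorem condEntropy_eq [Fintype S] [Fintype T] (hP : ∀ ω, 0 ≤ P ω) (X : Ω → S) (Y : Ω → T) :
    condEntropy P X Y = (entropy P (fun ω => (X ω, Y ω)) - entropy P Y) / Real.log 2 := by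
  have h := sum_prob_mul P (fun ω => (X ω, Y ω)) fun z =>
    Real.logb 2 (prob P (fun ω => X ω = z.1 ∧ Y ω = z.2) / prob P (fun ω => Y ω = z.2))
  simp only [Fintype.sum_prod_type, Prod.mk.injEq] at h
  rw [condEntropy, h, entropy, entropy, eq_div_iff (by positivity), neg_mul, Finset.sum_mul,
    sub_neg_eq_add, neg_add_eq_sub, ← neg_sub, neg_inj, ← Finset.sum_sub_distrib]
  refine Finset.sum_congr rfl fun ω _ => ?_
  rcases (hP ω).eq_or_lt with h0 | h0
  · simp [← h0]
  have h1 : 0 < prob P (fun ω' => X ω' = X ω ∧ Y ω' = Y ω) := prob_pos hP h0 ⟨rfl, rfl⟩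
  have h2 : 0 < prob P (fun ω' => Y ω' = Y ω) := prob_pos hP h0 rfl
  simp only [Prod.mk.injEq]
  rw [Real.logb, Real.log_div h1.ne' h2.ne']
  field_simp

theorem mutualInfo_eq [Fintype S] [Fintype T] (hP : ∀ ω, 0 ≤ P ω) (X : Ω → S) (Y : Ω → T) :
    mutualInfo P X Y =
      (entropy P X + entropy P Y - entropy P (fun ω => (X ω, Y ω))) / Real.log 2 := by
  have h := sum_prob_mul P (fun ω => (X ω, Y ω)) fun z =>
    Real.logb 2 (prob P (fun ω => X ω = z.1 ∧ Y ω = z.2) /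
      (prob P (fun ω => X ω = z.1) * prob P (fun ω => Y ω = z.2)))
  simp only [Fintype.sum_prod_type, Prod.mk.injEq] at h
  rw [mutualInfo, h, eq_div_iff (by positivity), Finset.sum_mul]
  simp only [entropy, ← Finset.sum_neg_distrib, ← Finset.sum_add_distrib,
    ← Finset.sum_sub_distrib]
  refine Finset.sum_congr rfl fun ω _ => ?_
  rcases (hP ω).eq_or_lt with h0 | h0
  · simp [← h0]
  have h1 : 0 < prob P (fun ω' => X ω' = X ω ∧ Y ω' = Y ω) := prob_pos hP h0 ⟨rfl, rfl⟩
  have h2 : 0 < prob P (fun ω' => Y ω' = Y ω) := prob_pos hP h0 rfl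
  have h3 : 0 < prob P (fun ω' => X ω' = X ω) := prob_pos hP h0 rfl
  simp only [Prod.mk.injEq]
  rw [Real.logb, Real.log_div h1.ne' (by positivity), Real.log_mul h3.ne' h2.ne']
  field_simp
  ring

theorem condMutualInfo_eq [Fintype S] [Fintype T] [Fintype V] (hP : ∀ ω, 0 ≤ P ω)
    (X : Ω → S) (Y : Ω → T) (Z : Ω → V) :
    condMutualInfo P X Y Z =
      (entropy P (fun ω => (X ω, Z ω)) + entropy P (fun ω => (Y ω, Z ω)) -
        entropy P (fun ω => (X ω, Y ω, Z ω)) - entropy P Z) / Real.log 2 := by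
  have h := sum_prob_mul P (fun ω => (X ω, Y ω, Z ω)) fun z =>
    Real.logb 2 (prob P (fun ω => X ω = z.1 ∧ Y ω = z.2.1 ∧ Z ω = z.2.2) *
      prob P (fun ω => Z ω = z.2.2) / (prob P (fun ω => X ω = z.1 ∧ Z ω = z.2.2) *
        prob P (fun ω => Y ω = z.2.1 ∧ Z ω = z.2.2)))
  simp only [Fintype.sum_prod_type, Prod.mk.injEq] at h
  rw [condMutualInfo, h, eq_div_iff (by positivity), Finset.sum_mul]
  simp only [entropy, ← Finset.sum_neg_distrib, ← Finset.sum_add_distrib,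
    ← Finset.sum_sub_distrib]
  refine Finset.sum_congr rfl fun ω _ => ?_
  rcases (hP ω).eq_or_lt with h0 | h0
  · simp [← h0]
  have h1 : 0 < prob P (fun ω' => X ω' = X ω ∧ Y ω' = Y ω ∧ Z ω' = Z ω) :=
    prob_pos hP h0 ⟨rfl, rfl, rfl⟩
  have h2 : 0 < prob P (fun ω' => Z ω' = Z ω) := prob_pos hP h0 rfl
  have h3 : 0 < prob P (fun ω' => X ω' = X ω ∧ Z ω' = Z ω) := prob_pos hP h0 ⟨rfl, rfl⟩
  have h4 : 0 < prob P (fun ω' => Y ω' = Y ω ∧ Z ω' = Z ω) := prob_pos hP h0 ⟨rfl, rfl⟩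
  simp only [Prod.mk.injEq]
  rw [Real.logb, Real.log_div (by positivity) (by positivity), Real.log_mul h1.ne' h2.ne',
    Real.log_mul h3.ne' h4.ne']
  field_simp
  ring

/-- Gibbs' inequality: the entropy is at most the cross entropy with respect to `q`. -/
theorem entropy_le_of_gibbs [Fintype S] (hP : P ∈ stdSimplex ℝ Ω) (X : Ω → S) {q : S → ℝ}
    (hq : ∀ x, 0 ≤ q x) (hq1 : ∑ x, q x ≤ 1) (hpos : ∀ ω, 0 < P ω → 0 < q (X ω)) :
    entropy P X ≤ -∑ ω, P ω * Real.log (q (X ω)) := by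
  have h := sum_prob_mul P X fun x => q x / prob P (fun ω => X ω = x)
  have h1 : ∑ x, prob P (fun ω => X ω = x) * (q x / prob P (fun ω => X ω = x)) ≤ 1 := by
    refine le_trans (Finset.sum_le_sum fun x _ => ?_) hq1
    rcases (prob_nonneg hP.1 (fun ω => X ω = x)).eq_or_lt with h0 | h0
    · simpa [← h0] using hq x
    · rw [mul_div_cancel₀ _ h0.ne']
  rw [h] at h1
  have h2 : ∑ ω, (P ω * Real.log (q (X ω)) -
      P ω * Real.log (prob P (fun ω' => X ω' = X ω))) ≤
      ∑ ω, (P ω * (q (X ω) / prob P (fun ω' => X ω' = X ω)) - P ω) := by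
    refine Finset.sum_le_sum fun ω _ => ?_
    rcases (hP.1 ω).eq_or_lt with h0 | h0
    · simp [← h0]
    have h3 : 0 < prob P (fun ω' => X ω' = X ω) := prob_pos hP.1 h0 rfl
    rw [← mul_sub, ← Real.log_div (hpos ω h0).ne' h3.ne', ← mul_sub_one]
    exact mul_le_mul_of_nonneg_left (Real.log_le_sub_one_of_pos (div_pos (hpos ω h0) h3)) h0.le
  rw [Finset.sum_sub_distrib, Finset.sum_sub_distrib, hP.2] at h2
  rw [entropy]
  linarith

/-- Subadditivity of entropy. -/
theorem entropy_pair_le [Fintype S] [Fintype T] (hP : P ∈ stdSimplex ℝ Ω) (X : Ω → S)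
    (Y : Ω → T) : entropy P (fun ω => (X ω, Y ω)) ≤ entropy P X + entropy P Y := by
  refine (entropy_le_of_gibbs hP (fun ω => (X ω, Y ω))
    (q := fun z => prob P (fun ω => X ω = z.1) * prob P (fun ω => Y ω = z.2))
    (fun z => mul_nonneg (prob_nonneg hP.1 _) (prob_nonneg hP.1 _)) ?_ ?_).trans_eq ?_
  · rw [Fintype.sum_prod_type]
    simp only [← Finset.mul_sum, sum_prob, hP.2, mul_one, le_refl]
  · exact fun ω h => mul_pos (prob_pos hP.1 h rfl) (prob_pos hP.1 h rfl)
  · rw [entropy, entropy, ← neg_add, ← Finset.sum_add_distrib, neg_inj]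
    refine Finset.sum_congr rfl fun ω _ => ?_
    rcases (hP.1 ω).eq_or_lt with h0 | h0
    · simp [← h0]
    rw [Real.log_mul (prob_fiber_pos hP.1 X h0).ne' (prob_fiber_pos hP.1 Y h0).ne', mul_add]

/-- The entropy of a variable with values in a finite set is at most the logarithm of the
cardinality. -/
theorem entropy_le_log_card [Fintype S] (hP : P ∈ stdSimplex ℝ Ω) (X : Ω → S) :
    entropy P X ≤ Real.log (Fintype.card S) := by
  rcases isEmpty_or_nonempty S with hS | hS
  · have : IsEmpty Ω := ⟨fun ω => hS.elim (X ω)⟩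
    simp [entropy]
  have hc : (0 : ℝ) < Fintype.card S := by exact_mod_cast Fintype.card_pos
  refine (entropy_le_of_gibbs hP X (q := fun _ => (Fintype.card S : ℝ)⁻¹)
    (fun _ => by positivity) ?_ (fun _ _ => by positivity)).trans_eq ?_
  · simp [hc.ne']
  · simp [← Finset.sum_mul, hP.2]

/-- Additivity of entropy for independent variables. -/
theorem entropy_pair_of_indep (hP : ∀ ω, 0 ≤ P ω) {X : Ω → S} {Y : Ω → T}
    (h : ∀ x y, prob P (fun ω => X ω = x ∧ Y ω = y) =
      prob P (fun ω => X ω = x) * prob P (fun ω => Y ω = y)) :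
    entropy P (fun ω => (X ω, Y ω)) = entropy P X + entropy P Y := by
  simp only [entropy, Prod.mk.injEq, h]
  rw [← neg_add, ← Finset.sum_add_distrib, neg_inj]
  refine Finset.sum_congr rfl fun ω _ => ?_
  rcases (hP ω).eq_or_lt with h0 | h0
  · simp [← h0]
  rw [Real.log_mul (prob_fiber_pos hP X h0).ne' (prob_fiber_pos hP Y h0).ne', mul_add]

/-- Fano's inequality, for an arbitrary parameter `t` in place of the optimal one. -/
theorem entropy_pair_le_of_estimator [Fintype S] [Fintype T] (hP : P ∈ stdSimplex ℝ Ω)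
    (X : Ω → S) (Y : Ω → T) (g : T → S) {t : ℝ} (ht : 0 < t) (ht1 : t < 1) :
    entropy P (fun ω => (X ω, Y ω)) ≤ entropy P Y - Real.log (1 - t) +
      prob P (fun ω => g (Y ω) ≠ X ω) * (Real.log (Fintype.card S) - Real.log t) := by
  classical
  rcases isEmpty_or_nonempty S with hS | hS
  · have : IsEmpty Ω := ⟨fun ω => hS.elim (X ω)⟩
    have := hP.2
    simp at this
  have hc : (0 : ℝ) < Fintype.card S := by exact_mod_cast Fintype.card_pos
  -- Reference conditional law for Gibbs: the guess `g y` with weight 1 − t, mixed with the uniform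
  -- law with weight t.
  set r : S → T → ℝ := fun x y => (if g y = x then 1 - t else 0) + t / Fintype.card S with hr
  have hr0 : ∀ x y, 0 < r x y := fun x y => by
    have : 0 < t / Fintype.card S := by positivity
    simp only [hr]; split_ifs <;> linarith
  have hr1 : ∀ y, ∑ x, r x y = 1 := fun y => by
    simp only [hr, Finset.sum_add_distrib, Finset.sum_ite_eq, Finset.mem_univ, if_true,
      Finset.sum_const, Finset.card_univ, nsmul_eq_mul]
    field_simp; ring
  refine (entropy_le_of_gibbs hP (fun ω => (X ω, Y ω))
    (q := fun z => r z.1 z.2 * prob P (fun ω => Y ω = z.2))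
    (fun z => mul_nonneg (hr0 _ _).le (prob_nonneg hP.1 _)) ?_ ?_).trans ?_
  · rw [Fintype.sum_prod_type, Finset.sum_comm]
    simp only [← Finset.sum_mul, hr1, one_mul, sum_prob, hP.2, le_refl]
  · exact fun ω h => mul_pos (hr0 _ _) (prob_pos hP.1 h rfl)
  · have key : ∑ ω, P ω * (-Real.log (r (X ω) (Y ω))) ≤
        ∑ ω, (P ω * (-Real.log (1 - t)) +
          (if g (Y ω) ≠ X ω then P ω else 0) * (Real.log (Fintype.card S) - Real.log t)) := by
      refine Finset.sum_le_sum fun ω _ => ?_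
      have hl : Real.log (1 - t) ≤ 0 := Real.log_nonpos (by linarith) (by linarith)
      by_cases h : g (Y ω) = X ω
      · have : Real.log (1 - t) ≤ Real.log (r (X ω) (Y ω)) := by
          refine Real.log_le_log (by linarith) ?_
          simp only [hr, h, if_true]
          have : 0 < t / Fintype.card S := by positivity
          linarith
        simpa [h] using mul_le_mul_of_nonneg_left this (hP.1 ω)
      · have : r (X ω) (Y ω) = t / Fintype.card S := by simp [hr, h]
        rw [this, Real.log_div ht.ne' hc.ne', if_pos h]
        have := hP.1 ω
        nlinarith
    rw [Finset.sum_add_distrib, ← Finset.sum_mul, ← Finset.sum_mul, hP.2,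
      ← prob_eq_sum_ite P (fun ω => g (Y ω) ≠ X ω)] at key
    have : -∑ ω, P ω * Real.log (r (X ω) (Y ω) * prob P (fun ω' => Y ω' = Y ω)) =
        ∑ ω, P ω * (-Real.log (r (X ω) (Y ω))) + entropy P Y := by
      rw [entropy, ← Finset.sum_neg_distrib, ← Finset.sum_neg_distrib, ← Finset.sum_add_distrib]
      refine Finset.sum_congr rfl fun ω _ => ?_
      rcases (hP.1 ω).eq_or_lt with h0 | h0
      · simp [← h0]
      rw [Real.log_mul (hr0 _ _).ne' (prob_fiber_pos hP.1 Y h0).ne']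
      ring
    rw [this]
    linarith

theorem prob_map {P' : Ω' → ℝ} {Z : Ω → Ω'} (h : ∀ z, P' z = prob P (fun ω => Z ω = z))
    (ev : Ω' → Prop) : prob P' ev = prob P (fun ω => ev (Z ω)) := by
  classical
  have := sum_prob_mul P Z fun z => if ev z then 1 else 0
  simpa [prob_eq_sum_ite P', prob_eq_sum_ite P (fun ω => ev (Z ω)), h] using this

/-- Entropy only depends on the law. -/
theorem entropy_map {P' : Ω' → ℝ} {Z : Ω → Ω'} (h : ∀ z, P' z = prob P (fun ω => Z ω = z))
    (X : Ω' → S) : entropy P' X = entropy P (fun ω => X (Z ω)) := by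
  simp only [entropy, prob_map h]
  rw [← sum_prob_mul P Z fun z => Real.log (prob P fun ω' => X (Z ω') = X z)]
  simp only [h]

end Entropy

/-! ### I.i.d. copies and the less-noisy order -/

section Iid

variable {A B E S T : Type*} {p : A × B × E → ℝ} {N : ℕ}

theorem iid_update (p : A × B × E → ℝ) (ω : Fin N → A × B × E) (i : Fin N) (x : A × B × E) :
    p (ω i) * iid p N (Function.update ω i x) = p x * iid p N ω := by
  simp only [iid]
  rw [← Finset.mul_prod_erase univ _ (Finset.mem_univ i),
    ← Finset.mul_prod_erase univ (fun j => p (ω j)) (Finset.mem_univ i), Function.update_self,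
    Finset.prod_congr rfl (g := fun j => p (ω j))]
  · ring
  · intro j hj
    rw [Function.update_of_ne (Finset.ne_of_mem_erase hj)]

theorem pos_of_iid_pos (hp : ∀ x, 0 ≤ p x) {ω : Fin N → A × B × E} (h : 0 < iid p N ω)
    (i : Fin N) : 0 < p (ω i) := by
  refine (hp _).lt_of_ne' fun h0 => h.ne' ?_
  exact Finset.prod_eq_zero (Finset.mem_univ i) h0

variable [Fintype A] [Fintype B] [Fintype E]

theorem sum_iid (p : A × B × E → ℝ) (N : ℕ) : ∑ ω, iid p N ω = (∑ x, p x) ^ N := by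
  classical
  simp only [iid, Fintype.sum_pow]

theorem iid_mem_stdSimplex (hp : p ∈ stdSimplex ℝ (A × B × E)) (N : ℕ) :
    iid p N ∈ stdSimplex ℝ (Fin N → A × B × E) :=
  ⟨fun _ => Finset.prod_nonneg fun i _ => hp.1 _, by rw [sum_iid, hp.2, one_pow]⟩

/-- Resampling one coordinate does not change an expectation. -/
theorem sum_iid_resample (hp : ∑ x, p x = 1) (i : Fin N) (F : (Fin N → A × B × E) → ℝ) :
    ∑ ω, iid p N ω * F ω = ∑ x, p x * ∑ ω, iid p N ω * F (Function.update ω i x) := by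
  -- Swapping a fresh letter with the i-th one is an involution that preserves the product weight,
  -- by `iid_update`.
  have hinv : Function.Involutive (fun z : (A × B × E) × (Fin N → A × B × E) =>
      (z.2 i, Function.update z.2 i z.1)) := fun z => by simp
  have h := Equiv.sum_comp hinv.toPerm fun z => p z.1 * (iid p N z.2 * F z.2)
  simp only [Function.Involutive.coe_toPerm, ← mul_assoc, iid_update] at h
  simp only [mul_assoc] at h
  rw [Fintype.sum_prod_type (α₁ := A × B × E) (α₂ := Fin N → A × B × E),
    Fintype.sum_prod_type (α₁ := A × B × E) (α₂ := Fin N → A × B × E)] at h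
  simp only [← Finset.mul_sum] at h
  rw [h, ← Finset.sum_mul, hp, one_mul]

theorem sum_iid_coord (hp : ∑ x, p x = 1) (i : Fin N) (g : A × B × E → ℝ) :
    ∑ ω, iid p N ω * g (ω i) = ∑ x, p x * g x := by
  rw [sum_iid_resample hp i fun ω => g (ω i)]
  simp [← Finset.sum_mul, sum_iid, hp]

theorem prob_iid_resample (hp : ∑ x, p x = 1) (i : Fin N) (ev : (Fin N → A × B × E) → Prop) :
    prob (iid p N) ev =
      ∑ x, p x * prob (iid p N) (fun ω => ev (Function.update ω i x)) := by
  classical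
  have := sum_iid_resample hp i fun ω => if ev ω then 1 else 0
  simpa [prob_eq_sum_ite] using this

/-- A coordinate is independent of every variable that does not depend on it. -/
theorem prob_iid_and_coord (hp : ∑ x, p x = 1) (i : Fin N) {V : (Fin N → A × B × E) → S}
    (hV : ∀ ω x, V (Function.update ω i x) = V ω) (X : A × B × E → T) (v : S) (y : T) :
    prob (iid p N) (fun ω => V ω = v ∧ X (ω i) = y) =
      prob (iid p N) (fun ω => V ω = v) * prob (iid p N) (fun ω => X (ω i) = y) := by
  classical
  rw [prob_iid_resample hp i, prob_iid_resample hp i fun ω => X (ω i) = y, Finset.mul_sum]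
  refine Finset.sum_congr rfl fun x _ => ?_
  simp only [hV, Function.update_self]
  by_cases h : X x = y <;> simp [h, prob_eq_sum_ite, sum_iid, hp, mul_comm]

theorem prob_iid_forall (p : A × B × E → ℝ) (N : ℕ) (Q : Fin N → A × B × E → Prop) :
    prob (iid p N) (fun ω => ∀ i, Q i (ω i)) = ∏ i, prob p (Q i) := by
  classical
  simp only [prob_eq_sum_ite, Finset.prod_univ_sum, Fintype.piFinset_univ, iid]
  refine Finset.sum_congr rfl fun ω _ => ?_
  by_cases h : ∀ i, Q i (ω i)
  · simp [h]
  · rw [if_neg h]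
    push Not at h
    obtain ⟨i, hi⟩ := h
    exact (Finset.prod_eq_zero (Finset.mem_univ i) (by simp [hi])).symm

theorem prob_iid_seq (p : A × B × E → ℝ) (N : ℕ) (X : A × B × E → S) (x : Fin N → S) :
    prob (iid p N) (fun ω => (fun i => X (ω i)) = x) = ∏ i, prob p (fun z => X z = x i) := by
  simpa only [funext_iff] using prob_iid_forall p N fun i z => X z = x i

theorem entropy_iid (hp : p ∈ stdSimplex ℝ (A × B × E)) (N : ℕ) (X : A × B × E → S) :
    entropy (iid p N) (fun ω i => X (ω i)) = N * entropy p X := by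
  have h : ∀ ω : Fin N → A × B × E,
      iid p N ω * Real.log (prob (iid p N) fun ω' => (fun i => X (ω' i)) = fun i => X (ω i)) =
        ∑ i, iid p N ω * Real.log (prob p fun z => X z = X (ω i)) := fun ω => by
    rcases ((iid_mem_stdSimplex hp N).1 ω).eq_or_lt with h0 | h0
    · simp [← h0]
    rw [prob_iid_seq p N X fun i => X (ω i), Real.log_prod, Finset.mul_sum]
    exact fun i _ => (prob_fiber_pos hp.1 X (pos_of_iid_pos hp.1 h0 i)).ne'
  simp only [entropy, h]
  rw [Finset.sum_comm]
  simp only [sum_iid_coord hp.2 _ fun x => Real.log (prob p fun z => X z = X x)]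
  simp

/-- The less-noisy inequality for a variable on the product space that depends on the `i`-th
letter only through the letter of Alice. -/
theorem LessNoisy.entropy_le (hp : p ∈ stdSimplex ℝ (A × B × E)) (hless : LessNoisy p)
    [Fintype S] (i : Fin N) (U : (Fin N → A × B × E) → S)
    (hU : ∀ ω x y, x.1 = y.1 → U (Function.update ω i x) = U (Function.update ω i y)) :
    entropy (iid p N) (fun ω => srcE (ω i)) - entropy (iid p N) (fun ω => (U ω, srcE (ω i))) ≤
      entropy (iid p N) (fun ω => srcB (ω i)) -
        entropy (iid p N) (fun ω => (U ω, srcB (ω i))) := by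
  classical
  have hq := iid_mem_stdSimplex hp N
  set e := Fintype.equivFin S
  -- The law of U once Alice's i-th letter is replaced by `a`. The other two components of the
  -- letter do not matter by `hU`, so those of `ω` are kept.
  set W : A → Fin (Fintype.card S) → ℝ := fun a u =>
    prob (iid p N) (fun ω => e (U (Function.update ω i (a, (ω i).2))) = u) with hW
  have hWs : ∀ a, W a ∈ stdSimplex ℝ (Fin (Fintype.card S)) := fun a =>
    ⟨fun u => prob_nonneg hq.1 _, by simp only [hW, sum_prob, hq.2]⟩
  have hnn : ∀ z, 0 ≤ withAux p W z := fun z => mul_nonneg (hp.1 _) ((hWs _).1 _)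
  have hlaw : ∀ z, withAux p W z = prob (iid p N) (fun ω => (ω i, e (U ω)) = z) := by
    rintro ⟨x, u⟩
    rw [prob_iid_resample hp.2 i]
    simp only [Function.update_self, Prod.mk.injEq, withAux]
    rw [Finset.sum_eq_single x]
    · simp only [hW, true_and, srcA]
      congr 1
      exact prob_congr fun ω => by rw [hU ω (x.1, (ω i).2) x rfl]
    · intro x' _ hx
      simp [hx, prob_eq_sum_ite]
    · simp
  have h := hless _ W hWs
  rw [mutualInfo_eq hnn, mutualInfo_eq hnn, div_le_div_iff_of_pos_right (by positivity)] at h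
  simp only [entropy_map hlaw] at h
  rw [entropy_congr (X := fun ω => (e (U ω), srcE (ω i))) (Y := fun ω => (U ω, srcE (ω i)))
      (fun _ _ => by simp),
    entropy_congr (X := fun ω => (e (U ω), srcB (ω i))) (Y := fun ω => (U ω, srcB (ω i)))
      (fun _ _ => by simp)] at h
  linarith

/-- The less-noisy property passes to `N` i.i.d. copies: `I(J; E^N) ≤ I(J; B^N)` for every
function `J` of `A^N`. -/
theorem LessNoisy.entropy_seq_le (hp : p ∈ stdSimplex ℝ (A × B × E)) (hless : LessNoisy p)
    [Fintype S] (J : (Fin N → A) → S) :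
    entropy (iid p N) seqE - entropy (iid p N) (fun ω => (J (seqA ω), seqE ω)) ≤
      entropy (iid p N) seqB - entropy (iid p N) (fun ω => (J (seqA ω), seqB ω)) := by
  classical
  have hq := iid_mem_stdSimplex hp N
  -- Hybrid observation: Bob's letters on `s`, Eve's elsewhere. The induction shows that I(J; Y s)
  -- does not fall below its value at `∅` as `s` grows.
  set Y : Finset (Fin N) → (Fin N → A × B × E) → Fin N → B ⊕ E := fun s ω j =>
    if j ∈ s then Sum.inl (srcB (ω j)) else Sum.inr (srcE (ω j)) with hY
  have key : ∀ s : Finset (Fin N),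
      entropy (iid p N) (Y ∅) - entropy (iid p N) (fun ω => (J (seqA ω), Y ∅ ω)) ≤
        entropy (iid p N) (Y s) - entropy (iid p N) (fun ω => (J (seqA ω), Y s ω)) := by
    intro s
    induction s using Finset.induction_on with
    | empty => exact le_rfl
    | insert i s hi ih =>
      refine ih.trans ?_
      set V : (Fin N → A × B × E) → {j // j ≠ i} → B ⊕ E := fun ω j => Y s ω j with hVdef
      have hV : ∀ ω x, V (Function.update ω i x) = V ω := fun ω x => by
        funext j
        simp [hVdef, hY, Function.update_of_ne j.2]
      have hE : ∀ ω ω', Y s ω = Y s ω' ↔ V ω = V ω' ∧ srcE (ω i) = srcE (ω' i) := by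
        intro ω ω'
        simp only [funext_iff, hVdef, Subtype.forall]
        constructor
        · exact fun h => ⟨fun j _ => h j, by simpa [hY, hi] using h i⟩
        · rintro ⟨h1, h2⟩ j
          by_cases hj : j = i
          · subst hj; simp [hY, hi, h2]
          · exact h1 j hj
      have hB : ∀ ω ω', Y (insert i s) ω = Y (insert i s) ω' ↔
          V ω = V ω' ∧ srcB (ω i) = srcB (ω' i) := by
        intro ω ω'
        have hne : ∀ j, j ≠ i → ∀ ω, Y (insert i s) ω j = Y s ω j := fun j hj ω => by
          simp [hY, hj]
        simp only [funext_iff, hVdef, Subtype.forall]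
        constructor
        · exact fun h => ⟨fun j hj => by rw [← hne j hj, ← hne j hj, h j],
            by simpa [hY] using h i⟩
        · rintro ⟨h1, h2⟩ j
          by_cases hj : j = i
          · subst hj; simp [hY, h2]
          · rw [hne j hj, hne j hj, h1 j hj]
      -- The auxiliary variable is J together with the hybrid letters off `i`. As the latter are
      -- independent of the i-th letter, the single-letter inequality is exactly the exchange of E_i
      -- for B_i.
      have hU := hless.entropy_le hp i (fun ω => (J (seqA ω), V ω)) fun ω x y hxy => by
        have : seqA (Function.update ω i x) = seqA (Function.update ω i y) := by
          funext j
          by_cases hj : j = i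
          · subst hj; simp [seqA, srcA, hxy]
          · simp [seqA, Function.update_of_ne hj]
        simp only [hV, this]
      have h1 : entropy (iid p N) (Y s) =
          entropy (iid p N) V + entropy (iid p N) (fun ω => srcE (ω i)) := by
        rw [← entropy_pair_of_indep hq.1 (prob_iid_and_coord hp.2 i hV srcE)]
        exact entropy_congr fun ω ω' => by simp [hE]
      have h2 : entropy (iid p N) (Y (insert i s)) =
          entropy (iid p N) V + entropy (iid p N) (fun ω => srcB (ω i)) := by
        rw [← entropy_pair_of_indep hq.1 (prob_iid_and_coord hp.2 i hV srcB)]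
        exact entropy_congr fun ω ω' => by simp [hB]
      have h3 : entropy (iid p N) (fun ω => (J (seqA ω), Y s ω)) =
          entropy (iid p N) (fun ω => ((J (seqA ω), V ω), srcE (ω i))) :=
        entropy_congr fun ω ω' => by simp [hE, and_assoc]
      have h4 : entropy (iid p N) (fun ω => (J (seqA ω), Y (insert i s) ω)) =
          entropy (iid p N) (fun ω => ((J (seqA ω), V ω), srcB (ω i))) :=
        entropy_congr fun ω ω' => by simp [hB, and_assoc]
      linarith
  have h0 : ∀ ω ω', Y ∅ ω = Y ∅ ω' ↔ seqE ω = seqE ω' := fun ω ω' => by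
    simp [hY, funext_iff, seqE]
  have h1 : ∀ ω ω', Y univ ω = Y univ ω' ↔ seqB ω = seqB ω' := fun ω ω' => by
    simp [hY, funext_iff, seqB]
  have h := key univ
  rwa [entropy_congr h0, entropy_congr h1,
    entropy_congr (X := fun ω => (J (seqA ω), Y ∅ ω)) (Y := fun ω => (J (seqA ω), seqE ω))
      (fun ω ω' => by simp [h0]),
    entropy_congr (X := fun ω => (J (seqA ω), Y univ ω)) (Y := fun ω => (J (seqA ω), seqB ω))
      (fun ω ω' => by simp [h1])] at h

theorem prob_withAux {k : ℕ} (W : A → Fin k → ℝ) (Y : A × B × E → S) (a : A) (y : S)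
    (u : Fin k) :
    prob (withAux p W) (fun z => srcA z.1 = a ∧ Y z.1 = y ∧ z.2 = u) =
      prob p (fun x => srcA x = a ∧ Y x = y) * W a u := by
  classical
  simp only [prob_eq_sum_ite, Fintype.sum_prod_type (γ := ℝ) (α₁ := A × B × E), Finset.sum_mul]
  refine Finset.sum_congr rfl fun x _ => ?_
  by_cases h : srcA x = a ∧ Y x = y
  · obtain ⟨rfl, rfl⟩ := h
    simp [withAux]
  · rw [if_neg h, zero_mul]
    exact Finset.sum_eq_zero fun u _ => if_neg fun h' => h ⟨h'.1, h'.2.1⟩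

theorem sum_withAux_mul {k : ℕ} {W : A → Fin k → ℝ} (hW : ∀ a, W a ∈ stdSimplex ℝ (Fin k))
    (g : A × B × E → ℝ) : ∑ z, withAux p W z * g z.1 = ∑ x, p x * g x := by
  rw [Fintype.sum_prod_type]
  refine Finset.sum_congr rfl fun x _ => ?_
  simp only [withAux, ← Finset.sum_mul, ← Finset.mul_sum, (hW _).2, mul_one]

/-- The chain rule `H(A, Y, U) = H(A, Y) + H(U | A)` for `U` generated from `A`. -/
theorem entropy_withAux (hp : p ∈ stdSimplex ℝ (A × B × E)) {k : ℕ} {W : A → Fin k → ℝ}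
    (hW : ∀ a, W a ∈ stdSimplex ℝ (Fin k)) (Y : A × B × E → S) :
    entropy (withAux p W) (fun z => (srcA z.1, Y z.1, z.2)) =
      entropy p (fun x => (srcA x, Y x)) -
        ∑ z, withAux p W z * Real.log (W (srcA z.1) z.2) := by
  have hnn : ∀ z, 0 ≤ withAux p W z := fun z => mul_nonneg (hp.1 _) ((hW _).1 _)
  rw [entropy, entropy, ← sum_withAux_mul hW fun x =>
    Real.log (prob p fun ω => (srcA ω, Y ω) = (srcA x, Y x)), ← neg_add',
    ← Finset.sum_add_distrib, neg_inj]
  refine Finset.sum_congr rfl fun z _ => ?_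
  rcases (hnn z).eq_or_lt with h0 | h0
  · simp [← h0]
  simp only [Prod.mk.injEq]
  have h1 : W (srcA z.1) z.2 ≠ 0 := fun h => h0.ne' (by simp [withAux, h])
  have h2 : 0 < p z.1 := (hp.1 _).lt_of_ne' fun h => h0.ne' (by simp [withAux, h])
  have h3 : 0 < prob p fun ω => srcA ω = srcA z.1 ∧ Y ω = Y z.1 := prob_pos hp.1 h2 ⟨rfl, rfl⟩
  rw [prob_withAux, Real.log_mul h3.ne' h1, mul_add]

theorem entropy_withAux_fst {k : ℕ} {W : A → Fin k → ℝ}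
    (hW : ∀ a, W a ∈ stdSimplex ℝ (Fin k)) (X : A × B × E → S) :
    entropy (withAux p W) (fun z => X z.1) = entropy p X := by
  classical
  refine (entropy_map (fun x => ?_) X).symm
  have := sum_withAux_mul (p := p) hW fun x' => if x' = x then 1 else 0
  simpa [prob_eq_sum_ite] using this.symm

/-- If `B` is less noisy than `E`, then a constant `U` maximizes `I(A;B|U) - I(A;E|U)`. -/
theorem LessNoisy.condMutualInfo_sub_le (hp : p ∈ stdSimplex ℝ (A × B × E))
    (hless : LessNoisy p) {k : ℕ} {W : A → Fin k → ℝ}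
    (hW : ∀ a, W a ∈ stdSimplex ℝ (Fin k)) :
    condMutualInfo (withAux p W) (fun ω => srcA ω.1) (fun ω => srcB ω.1) (fun ω => ω.2) -
        condMutualInfo (withAux p W) (fun ω => srcA ω.1) (fun ω => srcE ω.1) (fun ω => ω.2) ≤
      mutualInfo p srcA srcB - mutualInfo p srcA srcE := by
  have hnn : ∀ z, 0 ≤ withAux p W z := fun z => mul_nonneg (hp.1 _) ((hW _).1 _)
  have h := hless k W hW
  rw [mutualInfo_eq hnn, mutualInfo_eq hnn, div_le_div_iff_of_pos_right (by positivity)] at h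
  -- The two terms H(U|A) cancel, so the claim reduces to I(U;E) ≤ I(U;B).
  rw [condMutualInfo_eq hnn, condMutualInfo_eq hnn, mutualInfo_eq hp.1, mutualInfo_eq hp.1,
    ← sub_div, ← sub_div, div_le_div_iff_of_pos_right (by positivity),
    entropy_withAux hp hW, entropy_withAux hp hW]
  rw [entropy_withAux_fst hW, entropy_withAux_fst hW] at h
  have h1 : entropy (withAux p W) (fun z => (z.2, srcB z.1)) =
    entropy (withAux p W) (fun z => (srcB z.1, z.2)) :=
    entropy_congr fun _ _ => by simp [and_comm]
  have h2 : entropy (withAux p W) (fun z => (z.2, srcE z.1)) =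
    entropy (withAux p W) (fun z => (srcE z.1, z.2)) :=
    entropy_congr fun _ _ => by simp [and_comm]
  linarith

end Iid

/-! ### Converse: Fano and the less-noisy exchange -/

section Converse

variable {A B E S : Type*} [Fintype A] [Fintype B] [Fintype E] {p : A × B × E → ℝ} {N : ℕ}

theorem mutualInfo_sub_mutualInfo_eq (hp : p ∈ stdSimplex ℝ (A × B × E)) :
    mutualInfo p srcA srcB - mutualInfo p srcA srcE =
      (entropy p (fun ω => (srcA ω, srcE ω)) - entropy p srcE -
        (entropy p (fun ω => (srcA ω, srcB ω)) - entropy p srcB)) / Real.log 2 := by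
  rw [mutualInfo_eq hp.1, mutualInfo_eq hp.1]
  ring

theorem entropy_iid_pair (hp : p ∈ stdSimplex ℝ (A × B × E)) {T : Type*}
    (X : A × B × E → S) (Y : A × B × E → T) :
    entropy (iid p N) (fun ω => ((fun i => X (ω i)), fun i => Y (ω i))) =
      N * entropy p (fun x => (X x, Y x)) := by
  rw [← entropy_iid hp]
  exact entropy_congr fun _ _ => by simp [funext_iff, forall_and]

theorem Code.equivocation_eq (hp : p ∈ stdSimplex ℝ (A × B × E)) {R : ℝ} (c : Code A B R N) :
    c.equivocation p = (N * entropy p (fun ω => (srcA ω, srcE ω)) -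
      entropy (iid p N) (fun ω => (c.enc (seqA ω), seqE ω))) / Real.log 2 := by
  rw [Code.equivocation, condEntropy_eq (iid_mem_stdSimplex hp N).1, ← entropy_iid_pair hp]
  congr 2
  refine entropy_congr fun ω ω' => ?_
  change (seqA ω, c.enc (seqA ω), seqE ω) = (seqA ω', c.enc (seqA ω'), seqE ω') ↔
    (seqA ω, seqE ω) = (seqA ω', seqE ω')
  simp only [Prod.mk.injEq]
  exact ⟨fun h => ⟨h.1, h.2.2⟩, fun h => ⟨h.1, by rw [h.1], h.2⟩⟩

/-- Fano's inequality per letter, for a code with error probability at most `ε`. -/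
theorem Code.entropy_le_of_errorProb_lt (hp : p ∈ stdSimplex ℝ (A × B × E)) {R ε : ℝ}
    (hN : 1 ≤ N) (c : Code A B R N) (hε : 0 < ε) (hε1 : ε < 1) (hc : c.errorProb p < ε) :
    N * entropy p (fun ω => (srcA ω, srcB ω)) ≤
      entropy (iid p N) (fun ω => (c.enc (seqA ω), seqB ω)) +
        N * (-Real.log (1 - ε) + ε * (Real.log (Fintype.card A) - Real.log ε)) := by
  have h := entropy_pair_le_of_estimator (iid_mem_stdSimplex hp N) seqA
    (fun ω => (c.enc (seqA ω), seqB ω)) (fun y => c.dec y.1 y.2) hε hε1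
  have h1 : entropy (iid p N) (fun ω => (seqA ω, c.enc (seqA ω), seqB ω)) =
      N * entropy p (fun ω => (srcA ω, srcB ω)) := by
    rw [← entropy_iid_pair hp]
    refine entropy_congr fun ω ω' => ?_
    change _ ↔ (seqA ω, seqB ω) = (seqA ω', seqB ω')
    simp only [Prod.mk.injEq]
    exact ⟨fun h => ⟨h.1, h.2.2⟩, fun h => ⟨h.1, by rw [h.1], h.2⟩⟩
  have hN1 : (1 : ℝ) ≤ N := by exact_mod_cast hN
  have hl : Real.log (1 - ε) ≤ 0 := Real.log_nonpos (by linarith) (by linarith)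
  have hl2 : Real.log ε ≤ 0 := Real.log_nonpos hε.le hε1.le
  have hA : 0 ≤ Real.log (Fintype.card A) := Real.log_natCast_nonneg _
  rw [h1, Fintype.card_fun, Fintype.card_fin, Nat.cast_pow, Real.log_pow] at h
  -- N ≥ 1 allows −log ε to be charged once per letter, which makes the Fano term linear in N.
  have h2 : prob (iid p N) (fun ω => c.dec (c.enc (seqA ω)) (seqB ω) ≠ seqA ω) *
      (N * Real.log (Fintype.card A) - Real.log ε) ≤
      ε * (N * (Real.log (Fintype.card A) - Real.log ε)) := by
    refine mul_le_mul hc.le (by nlinarith) ?_ hε.le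
    nlinarith [mul_nonneg (zero_le_one.trans hN1) hA]
  nlinarith

theorem Code.entropy_enc_le (hp : p ∈ stdSimplex ℝ (A × B × E)) {R : ℝ} (c : Code A B R N) :
    entropy (iid p N) (fun ω => c.enc (seqA ω)) ≤ N * R * Real.log 2 := by
  refine (entropy_le_log_card (iid_mem_stdSimplex hp N) _).trans ?_
  have hne : Nonempty (Fin N → A × B × E) := by
    by_contra h
    rw [not_nonempty_iff] at h
    simpa using (iid_mem_stdSimplex hp N).2
  obtain ⟨ω⟩ := hne
  have hpos : 0 < ⌊(2 : ℝ) ^ ((N : ℝ) * R)⌋₊ := (c.enc (seqA ω)).pos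
  rw [Fintype.card_fin, ← Real.log_rpow two_pos]
  exact Real.log_le_log (by exact_mod_cast hpos) (Nat.floor_le (by positivity))

theorem tendsto_fano_nhdsGT (L : ℝ) :
    Filter.Tendsto (fun ε : ℝ => -Real.log (1 - ε) + ε * (L - Real.log ε))
      (nhdsWithin 0 (Set.Ioi 0)) (nhds 0) := by
  have h : ContinuousAt (fun ε : ℝ => -Real.log (1 - ε) + (ε * L + Real.negMulLog ε)) 0 := by
    refine ContinuousAt.add ?_ ?_
    · exact (ContinuousAt.log (by fun_prop) (by norm_num)).neg
    · exact (continuousAt_id.mul continuousAt_const).add Real.continuous_negMulLog.continuousAt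
  have h' := h.tendsto.mono_left (nhdsWithin_le_nhds (s := Set.Ioi 0))
  simp only [sub_zero, Real.log_one, neg_zero, zero_mul, Real.negMulLog_zero, add_zero] at h'
  refine h'.congr fun ε => ?_
  rw [Real.negMulLog]
  ring

/-- The converse of the coding theorem. -/
theorem LessNoisy.le_of_achievable (hp : p ∈ stdSimplex ℝ (A × B × E)) (hless : LessNoisy p)
    {R Δ : ℝ} (h : Achievable p R Δ) :
    condEntropy p srcA srcB ≤ R ∧
      Δ ≤ mutualInfo p srcA srcB - mutualInfo p srcA srcE := by
  have hlog : 0 < Real.log 2 := by positivity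
  set κ : ℝ → ℝ := fun ε =>
    -Real.log (1 - ε) + ε * (Real.log (Fintype.card A) - Real.log ε) with hκ
  have hκ0 : Filter.Tendsto κ (nhdsWithin 0 (Set.Ioi 0)) (nhds 0) := tendsto_fano_nhdsGT _
  have key : ∀ ε : ℝ, 0 < ε → ε < 1 →
      entropy p (fun ω => (srcA ω, srcB ω)) - entropy p srcB ≤
        (R + ε) * Real.log 2 + κ ε ∧
      Δ * Real.log 2 ≤ entropy p (fun ω => (srcA ω, srcE ω)) - entropy p srcE -
        (entropy p (fun ω => (srcA ω, srcB ω)) - entropy p srcB) + κ ε := by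
    intro ε hε hε1
    obtain ⟨N, hN, c, hΔ, herr⟩ := h ε hε
    have hNpos : (0 : ℝ) < N := by exact_mod_cast hN
    have hf := c.entropy_le_of_errorProb_lt hp hN hε hε1 herr
    rw [c.equivocation_eq hp, le_div_iff₀ hlog] at hΔ
    have hE : entropy (iid p N) seqE = N * entropy p srcE := entropy_iid hp N srcE
    have hB : entropy (iid p N) seqB = N * entropy p srcB := entropy_iid hp N srcB
    constructor
    · have h1 := c.entropy_enc_le hp
      have h2 := entropy_pair_le (iid_mem_stdSimplex hp N) (fun ω => c.enc (seqA ω)) seqB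
      rw [hB] at h2
      refine le_of_mul_le_mul_left ?_ hNpos
      linarith
    -- With J the encoder, H(f, E^N) is bounded below through H(f, B^N), which Fano bounds below by
    -- N·H(A,B) up to the error term.
    · have h1 := hless.entropy_seq_le hp c.enc
      rw [hE, hB] at h1
      refine le_of_mul_le_mul_left ?_ hNpos
      linarith
  have hev : ∀ᶠ ε : ℝ in nhdsWithin 0 (Set.Ioi 0), 0 < ε ∧ ε < 1 :=
    Ioo_mem_nhdsGT one_pos
  have hid : Filter.Tendsto (fun ε : ℝ => ε) (nhdsWithin 0 (Set.Ioi 0)) (nhds 0) :=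
    Filter.tendsto_id.mono_left nhdsWithin_le_nhds
  rw [condEntropy_eq hp.1, mutualInfo_sub_mutualInfo_eq hp, div_le_iff₀ hlog, le_div_iff₀ hlog]
  constructor
  · have ht := ((hid.const_add R).mul_const (Real.log 2)).add hκ0
    rw [add_zero, add_zero] at ht
    exact ge_of_tendsto ht (hev.mono fun ε hε => (key ε hε.1 hε.2).1)
  · have ht := hκ0.const_add (entropy p (fun ω => (srcA ω, srcE ω)) - entropy p srcE -
        (entropy p (fun ω => (srcA ω, srcB ω)) - entropy p srcB))
    rw [add_zero] at ht
    exact ge_of_tendsto ht (hev.mono fun ε hε => (key ε hε.1 hε.2).2)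

end Converse

/-! ### Chernoff bound, random binning and Slepian-Wolf coding -/

section Achievability

variable {A B E S T Ω : Type*} [Fintype A] [Fintype B] [Fintype E] [Fintype Ω]
  {p : A × B × E → ℝ} {P : Ω → ℝ} {N : ℕ}

/-- Chernoff's bound: a sum of i.i.d. variables exceeds a multiple of its mean with
exponentially small probability. -/
theorem exists_prob_iid_sum_le_pow (hp : p ∈ stdSimplex ℝ (A × B × E)) (Z : A × B × E → ℝ)
    {m : ℝ} (hm : ∑ x, p x * Z x < m) :
    ∃ ρ : ℝ, 0 ≤ ρ ∧ ρ < 1 ∧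
      ∀ N : ℕ, prob (iid p N) (fun ω => N * m ≤ ∑ i, Z (ω i)) ≤ ρ ^ N := by
  classical
  -- Moment generating function of Z − m: φ(0) = 1 and φ'(0) = E Z − m < 0, so φ(t) < 1 for some t >
  -- 0. That value is ρ.
  set φ : ℝ → ℝ := fun t => ∑ x, p x * Real.exp (t * (Z x - m)) with hφ
  have hderiv : HasDerivAt φ (∑ x, p x * (Z x - m)) 0 := by
    refine HasDerivAt.fun_sum fun x _ => HasDerivAt.const_mul _ ?_
    simpa using ((hasDerivAt_id (0 : ℝ)).mul_const (Z x - m)).exp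
  have hneg : ∑ x, p x * (Z x - m) < 0 := by
    simp only [mul_sub, Finset.sum_sub_distrib, ← Finset.sum_mul, hp.2]
    linarith
  have hφ0 : φ 0 = 1 := by simp [hφ, hp.2]
  obtain ⟨t, ht0, ht⟩ : ∃ t : ℝ, 0 < t ∧ φ t < 1 := by
    have h1 := (hasDerivAt_iff_tendsto_slope_zero.1 hderiv).eventually (gt_mem_nhds hneg)
    have h2 : ∀ᶠ t : ℝ in nhdsWithin 0 (Set.Ioi 0), t⁻¹ • (φ (0 + t) - φ 0) < 0 :=
      h1.filter_mono (nhdsWithin_mono _ fun t ht => ne_of_gt ht)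
    obtain ⟨t, h3, h4⟩ := (h2.and self_mem_nhdsWithin).exists
    have h4 : (0 : ℝ) < t := h4
    refine ⟨t, h4, ?_⟩
    rw [zero_add, hφ0, smul_eq_mul] at h3
    by_contra h5
    exact absurd h3 (not_lt.2 (mul_nonneg (inv_nonneg.2 h4.le) (by linarith)))
  refine ⟨φ t, Finset.sum_nonneg fun x _ => mul_nonneg (hp.1 x) (Real.exp_pos _).le, ht,
    fun N => ?_⟩
  rw [prob_eq_sum_ite]
  simp only [hφ, Fintype.sum_pow]
  refine Finset.sum_le_sum fun ω _ => ?_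
  rw [Finset.prod_mul_distrib, ← Real.exp_sum, ← Finset.mul_sum, Finset.sum_sub_distrib]
  have h0 : 0 ≤ ∏ i, p (ω i) := Finset.prod_nonneg fun i _ => hp.1 _
  split_ifs with h
  · refine le_mul_of_one_le_right h0 (Real.one_le_exp (mul_nonneg ht0.le ?_))
    simpa using h
  · positivity

/-- Two distinct points collide under a fraction of at most `1 / M` of the functions to
`Fin M`. -/
theorem card_mul_card_collision_le [Fintype S] [DecidableEq S] (M : ℕ) {x y : S} (hxy : x ≠ y) :
    M * #{f : S → Fin M | f y = f x} ≤ Fintype.card (S → Fin M) := by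
  have hcard : #((univ : Finset (Fin M)) ×ˢ ({f | f y = f x} : Finset (S → Fin M))) =
      M * #{f : S → Fin M | f y = f x} := by
    rw [Finset.card_product, Finset.card_univ, Fintype.card_fin]
  rw [← hcard, ← Finset.card_univ]
  -- The value overwritten at `x` can be recovered from the untouched `y`, since f y = f x; hence
  -- the map is injective.
  refine Finset.card_le_card_of_injOn (fun z => Function.update z.2 x z.1) (by simp) ?_
  rintro ⟨j, f⟩ hf ⟨k, g⟩ hg h
  simp only [Finset.coe_product, Set.mem_prod, Finset.mem_coe, Finset.mem_filter,
    Finset.mem_univ, true_and] at hf hg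
  simp only at h
  have hj : j = k := by simpa using congrFun h x
  refine Prod.ext hj (funext fun z => ?_)
  have hne : ∀ z, z ≠ x → f z = g z := fun z hz => by
    simpa [Function.update_of_ne hz] using congrFun h z
  by_cases hz : z = x
  · subst hz
    exact hf.symm.trans ((hne y hxy.symm).trans hg)
  · exact hne z hz

/-- Random binning: if at most `K` values of `X` are compatible with each value of `Y`, then a
suitable function of `X` with `M` values identifies `X` given `Y`, up to an additional error
`K / M`. -/
theorem exists_binning [Fintype S] (hP : P ∈ stdSimplex ℝ Ω) (X : Ω → S) (Y : Ω → T)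
    (typ : S → T → Prop) [∀ x y, Decidable (typ x y)] {K : ℝ}
    (hK : ∀ y, (#{x | typ x y} : ℝ) ≤ K) {M : ℕ} (hM : 0 < M) :
    ∃ (f : S → Fin M) (d : Fin M → T → S),
      prob P (fun ω => d (f (X ω)) (Y ω) ≠ X ω) ≤
        prob P (fun ω => ¬ typ (X ω) (Y ω)) + K / M := by
  classical
  have hne : Nonempty S := by
    by_contra h
    rw [not_nonempty_iff] at h
    have : IsEmpty Ω := ⟨fun ω => h.elim (X ω)⟩
    simpa using hP.2
  have : NeZero M := ⟨hM.ne'⟩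
  have hMr : (0 : ℝ) < M := by exact_mod_cast hM
  set coll : (S → Fin M) → Ω → Prop := fun f ω =>
    ∃ x, x ≠ X ω ∧ typ x (Y ω) ∧ f x = f (X ω) with hcoll
  have havg : ∑ f : S → Fin M, prob P (coll f) ≤ ∑ _f : S → Fin M, K / M := by
    simp only [prob_eq_sum_ite]
    rw [Finset.sum_comm]
    have hω : ∀ ω, ∑ f : S → Fin M, (if coll f ω then P ω else 0) ≤
        P ω * (Fintype.card (S → Fin M) * (K / M)) := by
      intro ω
      rw [← Finset.sum_filter, Finset.sum_const, nsmul_eq_mul, mul_comm]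
      refine mul_le_mul_of_nonneg_left ?_ (hP.1 ω)
      have hsub : ({f | coll f ω} : Finset (S → Fin M)) ⊆
          ({x | typ x (Y ω)} : Finset S).biUnion fun x =>
            if x = X ω then ∅ else ({f | f x = f (X ω)} : Finset (S → Fin M)) := by
        intro f hf
        obtain ⟨x, hx, hx1, hx2⟩ := (Finset.mem_filter.1 hf).2
        exact Finset.mem_biUnion.2 ⟨x, by simpa using hx1, by simpa [hx] using hx2⟩
      have h1 : (#{f | coll f ω} : ℝ) ≤ ∑ x with typ x (Y ω),
          (Fintype.card (S → Fin M) : ℝ) / M := by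
        refine (Nat.cast_le.2 ((Finset.card_le_card hsub).trans
          Finset.card_biUnion_le)).trans ?_
        rw [Nat.cast_sum]
        refine Finset.sum_le_sum fun x _ => ?_
        split_ifs with hx
        · simp only [Finset.card_empty, Nat.cast_zero]; positivity
        · rw [le_div_iff₀ hMr, mul_comm]
          exact_mod_cast card_mul_card_collision_le M (Ne.symm hx)
      refine h1.trans ?_
      rw [Finset.sum_const, nsmul_eq_mul, mul_div_assoc', mul_div_assoc', mul_comm]
      exact div_le_div_of_nonneg_right
        (mul_le_mul_of_nonneg_left (hK _) (Nat.cast_nonneg _)) hMr.le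
    refine (Finset.sum_le_sum fun ω _ => hω ω).trans_eq ?_
    rw [← Finset.sum_mul, hP.2, one_mul]
    simp
  obtain ⟨f, -, hf⟩ := Finset.exists_le_of_sum_le (Finset.univ_nonempty) havg
  -- The decoder picks any compatible point of the bin. It can err only if the true point is
  -- incompatible or another compatible point shares its bin; the default serves bins with no
  -- compatible point.
  refine ⟨f, fun j y => if h : ∃ x, typ x y ∧ f x = j then h.choose else Classical.arbitrary S,
    ?_⟩
  refine le_trans (prob_mono hP.1 (ev' := fun ω => ¬ typ (X ω) (Y ω) ∨ coll f ω) ?_)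
    ((prob_or_le hP.1 _ _).trans (add_le_add_right hf _))
  intro ω _ herr
  by_contra hcon
  push Not at hcon
  obtain ⟨h1, h2⟩ := hcon
  have h : ∃ x, typ x (Y ω) ∧ f x = f (X ω) := ⟨X ω, h1, rfl⟩
  simp only [dif_pos h] at herr
  exact h2 ⟨h.choose, herr, h.choose_spec.1, h.choose_spec.2⟩

/-- The number of sequences of conditional probability at least `exp (-c)` is at most
`exp c`. -/
theorem card_exp_neg_le_prod_le [DecidableEq A] {q : A → T → ℝ} (hq : ∀ a b, 0 ≤ q a b)
    (hq1 : ∀ b, ∑ a, q a b ≤ 1) (c : ℝ) (y : Fin N → T) :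
    (#{x : Fin N → A | Real.exp (-c) ≤ ∏ i, q (x i) (y i)} : ℝ) ≤ Real.exp c := by
  have h1 : ∑ x : Fin N → A, ∏ i, q (x i) (y i) ≤ 1 := by
    have := Finset.prod_univ_sum (fun _ : Fin N => (univ : Finset A)) fun i a => q a (y i)
    rw [Fintype.piFinset_univ] at this
    rw [← this]
    exact Finset.prod_le_one (fun i _ => Finset.sum_nonneg fun a _ => hq _ _) fun i _ => hq1 _
  have h2 : ∑ x : Fin N → A with Real.exp (-c) ≤ ∏ i, q (x i) (y i), Real.exp (-c) ≤ 1 := by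
    refine le_trans (Finset.sum_le_sum fun x hx => (Finset.mem_filter.1 hx).2)
      (le_trans (Finset.sum_le_sum_of_subset_of_nonneg (Finset.filter_subset _ _) ?_) h1)
    exact fun x _ _ => Finset.prod_nonneg fun i _ => hq _ _
  rw [Finset.sum_const, nsmul_eq_mul] at h2
  have h3 := mul_le_mul_of_nonneg_right h2 (Real.exp_pos c).le
  rwa [mul_assoc, ← Real.exp_add, neg_add_cancel, Real.exp_zero, mul_one, one_mul] at h3

/-- The Slepian-Wolf theorem for source coding with side information at the decoder, with an
exponential error bound. -/
theorem exists_slepianWolf (hp : p ∈ stdSimplex ℝ (A × B × E)) {r : ℝ}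
    (hr : entropy p (fun ω => (srcA ω, srcB ω)) - entropy p srcB < r) :
    ∃ ρ : ℝ, 0 ≤ ρ ∧ ρ < 1 ∧ ∀ N M : ℕ, 0 < M →
      ∃ (f : (Fin N → A) → Fin M) (d : Fin M → (Fin N → B) → Fin N → A),
        prob (iid p N) (fun ω => d (f (seqA ω)) (seqB ω) ≠ seqA ω) ≤
          ρ ^ N + Real.exp (N * r) / M := by
  classical
  -- The conditional law p(a|b). It vanishes when b has probability 0, so its sums over a are only
  -- at most 1.
  set q : A → B → ℝ := fun a b =>
    prob p (fun ω => srcA ω = a ∧ srcB ω = b) / prob p (fun ω => srcB ω = b) with hq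
  have hq0 : ∀ a b, 0 ≤ q a b := fun a b =>
    div_nonneg (prob_nonneg hp.1 _) (prob_nonneg hp.1 _)
  have hq1 : ∀ b, ∑ a, q a b ≤ 1 := fun b => by
    rw [← Finset.sum_div, sum_prob_and p srcA fun ω => srcB ω = b]
    exact div_self_le_one _
  have hmean : ∑ x, p x * -Real.log (q (srcA x) (srcB x)) =
      entropy p (fun ω => (srcA ω, srcB ω)) - entropy p srcB := by
    rw [entropy, entropy, neg_sub_neg, ← Finset.sum_sub_distrib]
    refine Finset.sum_congr rfl fun x _ => ?_
    rcases (hp.1 x).eq_or_lt with h0 | h0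
    · simp [← h0]
    have h1 : 0 < prob p (fun ω => srcA ω = srcA x ∧ srcB ω = srcB x) :=
      prob_pos hp.1 h0 ⟨rfl, rfl⟩
    simp only [hq, Prod.mk.injEq]
    rw [Real.log_div h1.ne' (prob_fiber_pos hp.1 srcB h0).ne']
    ring
  obtain ⟨ρ, hρ0, hρ1, hρ⟩ := exists_prob_iid_sum_le_pow hp
    (fun x => -Real.log (q (srcA x) (srcB x))) (hmean.trans_lt hr)
  refine ⟨ρ, hρ0, hρ1, fun N M hM => ?_⟩
  obtain ⟨f, d, hfd⟩ := exists_binning (iid_mem_stdSimplex hp N) seqA seqB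
    (fun (x : Fin N → A) (y : Fin N → B) => Real.exp (-(N * r)) ≤ ∏ i, q (x i) (y i))
    (card_exp_neg_le_prod_le hq0 hq1 (N * r)) hM
  refine ⟨f, d, hfd.trans (add_le_add_left ?_ _)⟩
  refine (prob_mono (iid_mem_stdSimplex hp N).1 fun ω hω h => ?_).trans (hρ N)
  have hqpos : ∀ i, 0 < q (srcA (ω i)) (srcB (ω i)) := fun i => by
    have := pos_of_iid_pos hp.1 hω i
    exact div_pos (prob_pos hp.1 this ⟨rfl, rfl⟩) (prob_pos hp.1 this rfl)
  simp only [not_le, seqA, seqB] at h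
  rw [← Real.log_lt_iff_lt_exp (Finset.prod_pos fun i _ => hqpos i),
    Real.log_prod fun i _ => (hqpos i).ne'] at h
  rw [Finset.sum_neg_distrib]
  linarith

/-- Gibbs' inequality against the equal mixture of the point mass at `x₀` and the uniform law. The
price log 2 does not depend on the alphabet, so it is negligible against a saving linear in N. -/
theorem entropy_le_of_atom [Fintype S] (hP : P ∈ stdSimplex ℝ Ω) (X : Ω → S) (x₀ : S) :
    entropy P X ≤
      Real.log 2 + prob P (fun ω => X ω ≠ x₀) * Real.log (Fintype.card S) := by
  classical
  have hc : (0 : ℝ) < Fintype.card S := by exact_mod_cast Fintype.card_pos_iff.2 ⟨x₀⟩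
  set q : S → ℝ := fun x => (if x = x₀ then 1 / 2 else 0) + 1 / (2 * Fintype.card S) with hq
  have hq0 : ∀ x, 0 < q x := fun x => by
    have : 0 < 1 / (2 * (Fintype.card S : ℝ)) := by positivity
    simp only [hq]; split_ifs <;> linarith
  refine (entropy_le_of_gibbs hP X (fun x => (hq0 x).le) ?_ fun ω _ => hq0 _).trans ?_
  · simp only [hq, Finset.sum_add_distrib, Finset.sum_ite_eq', Finset.mem_univ, if_true,
      Finset.sum_const, Finset.card_univ, nsmul_eq_mul]
    field_simp; norm_num
  · rw [prob_eq_sum_ite, Finset.sum_mul, ← one_mul (Real.log 2), ← hP.2, Finset.sum_mul,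
      ← Finset.sum_add_distrib, ← Finset.sum_neg_distrib]
    refine Finset.sum_le_sum fun ω _ => ?_
    have hpos : 0 < 1 / (2 * (Fintype.card S : ℝ)) := by positivity
    by_cases h : X ω = x₀
    · have : -Real.log 2 ≤ Real.log (q (X ω)) := by
        rw [← Real.log_inv]
        refine Real.log_le_log (by norm_num) ?_
        simp only [hq, h, if_true]
        linarith
      have := mul_le_mul_of_nonneg_left this (hP.1 ω)
      simp only [h, ne_eq, not_true_eq_false, if_false] at this ⊢
      linarith
    · have : q (X ω) = (2 * (Fintype.card S : ℝ))⁻¹ := by simp [hq, h]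
      rw [this, Real.log_inv, Real.log_mul two_ne_zero hc.ne', if_pos h]
      exact le_of_eq (by ring)

theorem prob_iid_prefix (hp : ∑ x, p x = 1) {m : ℕ} (hm : m ≤ N) (a : A) :
    prob (iid p N) (fun ω => ∀ i : Fin N, (i : ℕ) < m → seqA ω i = a) =
      prob p (fun x => srcA x = a) ^ m := by
  classical
  refine (prob_iid_forall p N fun i x => (i : ℕ) < m → srcA x = a).trans ?_
  have : ∀ i : Fin N, prob p (fun x => (i : ℕ) < m → srcA x = a) =
      if (i : ℕ) < m then prob p (fun x => srcA x = a) else 1 := fun i => by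
    by_cases h : (i : ℕ) < m <;> simp [h, prob_eq_sum_ite, hp]
  simp only [this, Finset.prod_ite, Finset.prod_const, one_pow, mul_one]
  congr 1
  rw [Fin.card_filter_val_lt, min_eq_right hm]

end Achievability

/-! ### Direct part: exact equivocation -/

section Direct

variable {A B E S T Ω : Type*} [Fintype A] [Fintype B] [Fintype E] [Fintype Ω]
  {p : A × B × E → ℝ} {P : Ω → ℝ} {N : ℕ}

theorem entropy_le_entropy_pair (hP : ∀ ω, 0 ≤ P ω) (X : Ω → S) (Y : Ω → T) :
    entropy P Y ≤ entropy P (fun ω => (X ω, Y ω)) := by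
  refine neg_le_neg (Finset.sum_le_sum fun ω _ => ?_)
  rcases (hP ω).eq_or_lt with h0 | h0
  · simp [← h0]
  refine mul_le_mul_of_nonneg_left (Real.log_le_log (prob_fiber_pos hP _ h0) ?_) h0.le
  exact prob_mono hP fun ω' _ h => congrArg Prod.snd h

theorem entropy_lt_entropy_pair (hP : ∀ ω, 0 ≤ P ω) (X : Ω → S) (Y : Ω → T) {ω₀ : Ω}
    (h₀ : 0 < P ω₀) (h : prob P (fun ω => X ω = X ω₀ ∧ Y ω = Y ω₀) <
      prob P (fun ω => Y ω = Y ω₀)) :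
    entropy P Y < entropy P (fun ω => (X ω, Y ω)) := by
  refine neg_lt_neg (Finset.sum_lt_sum (fun ω _ => ?_) ⟨ω₀, Finset.mem_univ _, ?_⟩)
  · rcases (hP ω).eq_or_lt with h0 | h0
    · simp [← h0]
    refine mul_le_mul_of_nonneg_left (Real.log_le_log (prob_fiber_pos hP _ h0) ?_) h0.le
    exact prob_mono hP fun ω' _ h => congrArg Prod.snd h
  · refine mul_lt_mul_of_pos_left (Real.log_lt_log (prob_fiber_pos hP _ h₀) ?_) h₀
    simpa only [Prod.mk.injEq] using h

/-- The equivocation of a code is at least `H(A^N | E^N) - H(f(A^N))`. -/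
theorem Code.le_equivocation (hp : p ∈ stdSimplex ℝ (A × B × E)) {R Δ : ℝ} (c : Code A B R N)
    (hΔ : Δ ≤ mutualInfo p srcA srcB - mutualInfo p srcA srcE)
    (hc : entropy (iid p N) (fun ω => (c.enc (seqA ω), seqE ω)) ≤
      N * (entropy p (fun ω => (srcA ω, srcB ω)) - entropy p srcB) + N * entropy p srcE) :
    N * Δ ≤ c.equivocation p := by
  have hlog : 0 < Real.log 2 := by positivity
  rw [mutualInfo_sub_mutualInfo_eq hp, le_div_iff₀ hlog] at hΔ
  rw [c.equivocation_eq hp, le_div_iff₀ hlog]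
  have := mul_le_mul_of_nonneg_left hΔ (Nat.cast_nonneg (α := ℝ) N)
  linarith

/-- If Bob's letter determines Alice's, then a constant encoder suffices. -/
theorem achievable_of_determined (hp : p ∈ stdSimplex ℝ (A × B × E))
    (hdet : ∀ x, 0 < p x → prob p (fun ω => srcB ω = srcB x) ≤
      prob p (fun ω => srcA ω = srcA x ∧ srcB ω = srcB x)) {R Δ : ℝ}
    (hR : condEntropy p srcA srcB ≤ R)
    (hΔ : Δ ≤ mutualInfo p srcA srcB - mutualInfo p srcA srcE) : Achievable p R Δ := by
  classical
  have hH := entropy_le_entropy_pair hp.1 (srcA (A := A) (B := B) (E := E)) srcB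
  have hR0 : 0 ≤ R := by
    refine le_trans ?_ hR
    rw [condEntropy_eq hp.1]
    exact div_nonneg (by linarith) (by positivity)
  -- Two possible letters of Alice for the same letter of Bob would have joint masses exceeding that
  -- of Bob's letter.
  have huniq : ∀ x y, 0 < p x → 0 < p y → srcB x = srcB y → srcA x = srcA y := by
    intro x y hx hy hxy
    by_contra hne
    have h1 := hdet x hx
    have h2 : 0 < prob p (fun ω => srcA ω = srcA y ∧ srcB ω = srcB x) :=
      prob_pos hp.1 hy ⟨rfl, hxy.symm⟩
    have h3 : ∑ a ∈ {srcA x, srcA y}, prob p (fun ω => srcA ω = a ∧ srcB ω = srcB x) ≤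
        ∑ a, prob p (fun ω => srcA ω = a ∧ srcB ω = srcB x) :=
      Finset.sum_le_sum_of_subset_of_nonneg (Finset.subset_univ _)
        fun a _ _ => prob_nonneg hp.1 _
    rw [Finset.sum_pair hne, sum_prob_and p srcA fun ω => srcB ω = srcB x] at h3
    linarith
  have hne : Nonempty A := by
    by_contra h
    rw [not_nonempty_iff] at h
    simpa using hp.2
  intro ε hε
  have hM : 0 < ⌊(2 : ℝ) ^ (((1 : ℕ) : ℝ) * (R + ε))⌋₊ := by
    refine Nat.floor_pos.2 (Real.one_le_rpow one_le_two ?_)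
    rw [Nat.cast_one, one_mul]
    linarith
  set d : B → A := fun b =>
    if h : ∃ x, 0 < p x ∧ srcB x = b then srcA h.choose else Classical.arbitrary A with hd
  have hdx : ∀ x, 0 < p x → d (srcB x) = srcA x := fun x hx => by
    have h : ∃ y, 0 < p y ∧ srcB y = srcB x := ⟨x, hx, rfl⟩
    simp only [hd, dif_pos h]
    exact huniq _ _ h.choose_spec.1 hx h.choose_spec.2
  refine ⟨1, le_rfl, ⟨fun _ => ⟨0, hM⟩, fun _ y i => d (y i)⟩, ?_, ?_⟩
  · refine Code.le_equivocation hp _ hΔ ?_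
    rw [entropy_congr (Y := fun ω i => srcE (ω i))
      (fun ω ω' => by simp only [Prod.mk.injEq, true_and]; rfl), entropy_iid hp]
    have : 0 ≤ ((1 : ℕ) : ℝ) *
        (entropy p (fun ω => (srcA ω, srcB ω)) - entropy p srcB) :=
      mul_nonneg (Nat.cast_nonneg _) (by linarith)
    linarith
  · refine lt_of_le_of_lt ((prob_mono (iid_mem_stdSimplex hp 1).1
      (ev' := fun _ => False) fun ω hω h => ?_).trans_eq ?_) hε
    · exact h (funext fun i => hdx _ (pos_of_iid_pos hp.1 hω i))
    · simp [prob]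

/-- If Bob's letter does not determine Alice's, then random binning, made constant on an event of
small but fixed probability, attains the equivocation exactly. -/
theorem achievable_of_not_determined (hp : p ∈ stdSimplex ℝ (A × B × E)) {x₀ : A × B × E}
    (hx₀ : 0 < p x₀) (hdet : prob p (fun ω => srcA ω = srcA x₀ ∧ srcB ω = srcB x₀) <
      prob p (fun ω => srcB ω = srcB x₀)) {R Δ : ℝ}
    (hR : condEntropy p srcA srcB ≤ R)
    (hΔ : Δ ≤ mutualInfo p srcA srcB - mutualInfo p srcA srcE) : Achievable p R Δ := by
  classical
  intro ε hε
  have hlog : 0 < Real.log 2 := by positivity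
  set h := entropy p (fun ω => (srcA ω, srcB ω)) - entropy p srcB with hh
  have hpos : 0 < h := sub_pos.2 (entropy_lt_entropy_pair hp.1 srcA srcB hx₀ hdet)
  rw [condEntropy_eq hp.1, div_le_iff₀ hlog] at hR
  set π := prob p (fun ω => srcA ω = srcA x₀) with hπ
  have hπ0 : 0 < π := prob_fiber_pos hp.1 srcA hx₀
  -- Given Bob's letter at `x₀`, Alice's may differ from `srcA x₀` with positive probability.
  have hπ1 : π < 1 := by
    have h1 := prob_add_prob_not p fun ω => srcB ω = srcB x₀
    have h2 : π ≤ prob p (fun ω => (srcA ω = srcA x₀ ∧ srcB ω = srcB x₀) ∨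
        ¬ srcB ω = srcB x₀) :=
      prob_mono hp.1 fun ω _ h => by tauto
    have h3 := h2.trans (prob_or_le hp.1 _ _)
    rw [hp.2] at h1
    linarith
  obtain ⟨m, hm⟩ := exists_pow_lt_of_lt_one (half_pos hε) hπ1
  set s := π ^ m with hs
  have hs0 : 0 < s := pow_pos hπ0 m
  have hs1 : s ≤ 1 := pow_le_one₀ hπ0.le hπ1.le
  -- The first bound fits e^{N(h+δ)} bins into the 2^{N(R+ε)} indices; the second gives (1 − s)(h +
  -- δ) ≤ h − sh/2.
  set δ := min (ε * Real.log 2) (s * h / 2) with hδ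
  have hδ0 : 0 < δ := lt_min (by positivity) (by positivity)
  have hδ1 : δ ≤ ε * Real.log 2 := min_le_left _ _
  have hδ2 : δ ≤ s * h / 2 := min_le_right _ _
  obtain ⟨ρ, hρ0, hρ1, hcode⟩ := exists_slepianWolf hp (r := h + δ / 2) (by linarith)
  have hlim : Filter.Tendsto (fun N : ℕ => ρ ^ N + 2 * Real.exp (-(δ / 2)) ^ N) Filter.atTop
      (nhds 0) := by
    have h1 := tendsto_pow_atTop_nhds_zero_of_lt_one hρ0 hρ1
    have h2 := tendsto_pow_atTop_nhds_zero_of_lt_one (Real.exp_pos (-(δ / 2))).le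
      (Real.exp_lt_one_iff.2 (by linarith))
    simpa using h1.add (h2.const_mul 2)
  -- The three demands: binning error below ε/2, the saving N·sh/2 covers log 2, and the prefix of
  -- length m fits.
  obtain ⟨N, hNerr, hNlog, hNm⟩ : ∃ N : ℕ,
      ρ ^ N + 2 * Real.exp (-(δ / 2)) ^ N < ε / 2 ∧ Real.log 2 / (s * h / 2) ≤ N ∧ m + 1 ≤ N :=
    ((hlim.eventually (gt_mem_nhds (half_pos hε))).and
      ((tendsto_natCast_atTop_atTop.eventually_ge_atTop _).and
        (Filter.eventually_ge_atTop (m + 1)))).exists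
  have hq := iid_mem_stdSimplex hp N
  have hN0 : (0 : ℝ) ≤ N := Nat.cast_nonneg N
  have hNlog' : Real.log 2 ≤ N * (s * h / 2) := by
    rwa [div_le_iff₀ (by positivity)] at hNlog
  -- The bins have rate h + δ even when R is larger, since the entropy of the index must stay close
  -- to Nh. The floor costs at most a factor 2.
  set M := ⌊Real.exp (N * (h + δ))⌋₊ with hM
  have hexp1 : 1 ≤ Real.exp (N * (h + δ)) := Real.one_le_exp (by positivity)
  have hM0 : 0 < M := Nat.floor_pos.2 hexp1
  have hMle : (M : ℝ) ≤ Real.exp (N * (h + δ)) := Nat.floor_le (by positivity)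
  have hMr : (0 : ℝ) < M := by exact_mod_cast hM0
  have hMge : Real.exp (N * (h + δ)) ≤ 2 * M := by
    have h1 := Nat.lt_floor_add_one (Real.exp (N * (h + δ)))
    have h2 : (1 : ℝ) ≤ M := by exact_mod_cast hM0
    linarith
  have hMM : M ≤ ⌊(2 : ℝ) ^ ((N : ℝ) * (R + ε))⌋₊ := by
    refine Nat.floor_le_floor ?_
    rw [Real.rpow_def_of_pos two_pos, Real.exp_le_exp]
    have : h + δ ≤ Real.log 2 * (R + ε) := by linarith
    have := mul_le_mul_of_nonneg_left this hN0
    linarith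
  obtain ⟨f, d, hfd⟩ := hcode N M hM0
  have hratio : Real.exp (N * (h + δ / 2)) / M ≤ 2 * Real.exp (-(δ / 2)) ^ N := by
    rw [div_le_iff₀ hMr, ← Real.exp_nat_mul]
    have : Real.exp (N * (h + δ / 2)) =
        Real.exp (N * -(δ / 2)) * Real.exp (N * (h + δ)) := by
      rw [← Real.exp_add]; ring_nf
    rw [this]
    nlinarith [mul_le_mul_of_nonneg_left hMge (Real.exp_pos (N * -(δ / 2))).le]
  -- The sacrificed event depends on the first m letters of Alice only, so its probability s = π^m <
  -- ε/2 does not depend on N.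
  set inS : (Fin N → A) → Prop := fun x => ∀ i : Fin N, (i : ℕ) < m → x i = srcA x₀ with hinS
  have hprobS : prob (iid p N) (fun ω => inS (seqA ω)) = s :=
    prob_iid_prefix hp.2 (by omega) (srcA x₀)
  set f' : (Fin N → A) → Fin M := fun x => if inS x then ⟨0, hM0⟩ else f x with hf'
  -- Indices from M on are never sent, so the decoder's value there is arbitrary.
  let c : Code A B (R + ε) N :=
    ⟨fun x => Fin.castLE hMM (f' x),
      fun j y => if hj : (j : ℕ) < M then d ⟨j, hj⟩ y else fun _ => srcA x₀⟩
  refine ⟨N, by omega, c, c.le_equivocation hp hΔ ?_, ?_⟩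
  · have h1 : entropy (iid p N) (fun ω => c.enc (seqA ω)) =
        entropy (iid p N) (fun ω => f' (seqA ω)) :=
      entropy_congr fun ω ω' => (Fin.castLE_injective hMM).eq_iff
    have h2 := entropy_le_of_atom hq (fun ω => f' (seqA ω)) ⟨0, hM0⟩
    have h3 : prob (iid p N) (fun ω => f' (seqA ω) ≠ ⟨0, hM0⟩) ≤ 1 - s := by
      have h4 := prob_add_prob_not (iid p N) fun ω => inS (seqA ω)
      rw [hq.2, hprobS] at h4
      refine (prob_mono hq.1 fun ω _ hω => ?_).trans_eq (eq_sub_of_add_eq' h4)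
      intro hS
      exact hω (if_pos hS)
    have h5 : Real.log M ≤ N * (h + δ) := (Real.log_le_iff_le_exp hMr).2 hMle
    rw [Fintype.card_fin] at h2
    have h6 : prob (iid p N) (fun ω => f' (seqA ω) ≠ ⟨0, hM0⟩) * Real.log M ≤
        (1 - s) * (N * (h + δ)) :=
      mul_le_mul h3 h5 (Real.log_natCast_nonneg _) (by linarith)
    have h7 : (1 - s) * (h + δ) ≤ h - s * h / 2 := by nlinarith [mul_pos hs0 hδ0]
    have h8 := mul_le_mul_of_nonneg_left h7 hN0
    have h9 := entropy_pair_le hq (fun ω => c.enc (seqA ω)) seqE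
    have h10 : entropy (iid p N) seqE = N * entropy p srcE := entropy_iid hp N srcE
    rw [h1, h10] at h9
    linarith
  · have h1 : c.errorProb p ≤ prob (iid p N) (fun ω =>
        inS (seqA ω) ∨ d (f (seqA ω)) (seqB ω) ≠ seqA ω) := by
      refine prob_mono hq.1 fun ω _ hω => ?_
      by_contra hcon
      push Not at hcon
      refine hω ?_
      simp only [c, hf', if_neg hcon.1, Fin.val_castLE, Fin.is_lt, dif_pos, Fin.eta]
      exact hcon.2
    have h2 := prob_or_le hq.1 (fun ω => inS (seqA ω))
      fun ω => d (f (seqA ω)) (seqB ω) ≠ seqA ω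
    linarith

/-- The direct part of the coding theorem. -/
theorem achievable_of_le (hp : p ∈ stdSimplex ℝ (A × B × E)) {R Δ : ℝ}
    (hR : condEntropy p srcA srcB ≤ R)
    (hΔ : Δ ≤ mutualInfo p srcA srcB - mutualInfo p srcA srcE) : Achievable p R Δ := by
  by_cases hdet : ∀ x, 0 < p x → prob p (fun ω => srcB ω = srcB x) ≤
      prob p (fun ω => srcA ω = srcA x ∧ srcB ω = srcB x)
  · exact achievable_of_determined hp hdet hR hΔ
  · push Not at hdet
    obtain ⟨x, hx, hlt⟩ := hdet
    exact achievable_of_not_determined hp hx hlt hR hΔ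

end Direct

end SecureCompression

theorem corollary2 {A B E : Type*} [Fintype A] [Fintype B] [Fintype E]
    (p : A × B × E → ℝ) (hp : p ∈ stdSimplex ℝ (A × B × E))
    (hless : SecureCompression.LessNoisy p) :
    (∀ R Δ : ℝ, SecureCompression.Achievable p R Δ ↔
      SecureCompression.condEntropy p SecureCompression.srcA SecureCompression.srcB ≤ R ∧
      Δ ≤ SecureCompression.mutualInfo p SecureCompression.srcA SecureCompression.srcB -
        SecureCompression.mutualInfo p SecureCompression.srcA SecureCompression.srcE) ∧
    (∀ (k : ℕ) (W : A → Fin k → ℝ), (∀ a, W a ∈ stdSimplex ℝ (Fin k)) →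
      SecureCompression.condMutualInfo (SecureCompression.withAux p W)
          (fun ω => SecureCompression.srcA ω.1) (fun ω => SecureCompression.srcB ω.1)
          (fun ω => ω.2) -
        SecureCompression.condMutualInfo (SecureCompression.withAux p W)
          (fun ω => SecureCompression.srcA ω.1) (fun ω => SecureCompression.srcE ω.1)
          (fun ω => ω.2) ≤
      SecureCompression.mutualInfo p SecureCompression.srcA SecureCompression.srcB -
        SecureCompression.mutualInfo p SecureCompression.srcA SecureCompression.srcE) := by
  exact ⟨fun R Δ => ⟨fun h => hless.le_of_achievable hp h,
    fun h => SecureCompression.achievable_of_le hp h.1 h.2⟩,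
    fun k W hW => hless.condMutualInfo_sub_le hp hW⟩
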